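/- Write $\mathbb{H}$ for the upper half-plane, $\Gamma_\infty=\{\left(\begin{smallmatrix}1&n\\0&1\end{smallmatrix}\right): n\in\mathbb{Z}\}$, and, for $m\in 2\mathbb{Z}$ and an integer $\ell\ge 0$ with $m\ge 4+2\ell$, and $\mathfrak{z},z\in\mathbb{H}$ not equivalent under $\mathrm{SL}_2(\mathbb{Z})$, $$ H_{m,\ell}(\mathfrak{z},z):=2\pi i\sum_{M=\left(\begin{smallmatrix}a&b\\c&d\end{smallmatrix}\right)\in\Gamma_\infty\backslash \mathrm{SL}_2(\mathbb{Z})}\frac{(c\mathfrak{z}+d)^{-m}\,\operatorname{Im}(M\mathfrak{z})^{-\ell}}{1-e^{2\pi i(z-M\mathfrak{z})}},\qquad H_m:=H_{m,0},\qquad H_{m,\ell}^{(r)}:=\frac{\partial^r}{\partial z^r}H_{m,\ell}. $$ Let $E_2(z)=1-24\sum_{n\ge1}\sum_{d\mid n}d\,e^{2\pi i nz}$, $\widehat{E}_2(\mathfrak{z})=E_2(\mathfrak{z})-\frac{3}{\pi \operatorname{Im}(\mathfrak{z})}$, and $$ \mathcal{F}_{m,\ell}^{(r)}(\mathfrak{z},z):=\sum_{j=0}^{\ell}\binom{\ell}{j}\left(\frac{3}{\pi}\right)^{\ell-j}\widehat{E}_2(\mathfrak{z})^j\,H_{m-2j,\ell-j}^{(r)}(\mathfrak{z},z).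 $$ **Proposition.** Let $\ell,r\ge 0$ be integers, let $m$ be an even integer with $m\geq 4+2\ell$, and let $z\in\mathbb{H}$ not be an elliptic fixed point of $\mathrm{SL}_2(\mathbb{Z})$. Then, for every $\mathfrak{z}\in\mathbb{H}\setminus\mathrm{SL}_2(\mathbb{Z})z$, the series $H_m(\mathfrak{z},\cdot)$ and $H_{m-2j,\ell-j}(\mathfrak{z},\cdot)$ $(0\le j\le \ell)$ converge absolutely to holomorphic functions in a neighbourhood of $z$, and the function $$ \mathfrak{z}\mapsto \mathcal{F}_{m,\ell}^{(r)}(\mathfrak{z},z)-\frac{\partial^r}{\partial z^r}\Big(E_2(z)^{\ell}H_m(\mathfrak{z},z)\Big), $$ defined on $\mathbb{H}\setminus \mathrm{SL}_2(\mathbb{Z})z$, extends to a holomorphic cusp form of weight $m$ for $\mathrm{SL}_2(\mathbb{Z})$ on all of $\mathbb{H}$. -/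

import Mathlib

open scoped MatrixGroups ModularForm Topology UpperHalfPlane
open UpperHalfPlane (ofComplex)

noncomputable section

namespace MeroPoincare

/-- `Γ_∞`, the group of the matrices `(1 n; 0 1)` with `n ∈ ℤ`, generated by `T = (1 1; 0 1)`. -/
def GammaInf : Subgroup SL(2, ℤ) := Subgroup.zpowers ModularGroup.T

/-- The set of cosets `Γ_∞ \ SL₂(ℤ)`: here `M` and `M'` are identified iff `M' ∈ Γ_∞ M`. -/
abbrev Cosets : Type := Quotient (QuotientGroup.rightRel GammaInf)

/-- The seed `𝔷 ↦ Im(𝔷)^(-ℓ) / (1 - exp(2πi(w - 𝔷)))`. -/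
def seed (l : ℕ) (w : ℂ) (τ : ℍ) : ℂ :=
  (((τ.im : ℝ) : ℂ) ^ l)⁻¹ / (1 - Complex.exp (2 * (Real.pi : ℂ) * Complex.I * (w - (τ : ℂ))))

lemma seed_slash_T (m : ℤ) (l : ℕ) (w : ℂ) : (seed l w) ∣[m] ModularGroup.T = seed l w := by
  ext τ
  have h1 : UpperHalfPlane.denom (ModularGroup.T : SL(2, ℤ)) τ = 1 := by
    rw [ModularGroup.denom_apply]; simp [ModularGroup.T]
  have h2 : ModularGroup.T • τ = (1 : ℝ) +ᵥ τ := UpperHalfPlane.modular_T_smul τ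
  rw [ModularForm.SL_slash_apply, h1, h2]
  have h3 : 2 * (Real.pi : ℂ) * Complex.I * (w - (((1 : ℝ) +ᵥ τ : ℍ) : ℂ))
      = 2 * (Real.pi : ℂ) * Complex.I * (w - (τ : ℂ)) - 2 * (Real.pi : ℂ) * Complex.I := by
    rw [UpperHalfPlane.coe_vadd]; push_cast; ring
  simp only [seed, one_zpow, mul_one]
  rw [h3, Complex.exp_periodic.sub_eq, UpperHalfPlane.vadd_im]

lemma seed_slash_GammaInf (m : ℤ) (l : ℕ) (w : ℂ) {g : SL(2, ℤ)} (hg : g ∈ GammaInf) :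
    (seed l w) ∣[m] g = seed l w := by
  have hT : ModularGroup.T ∈ (⟨⟨⟨{g : SL(2, ℤ) | (seed l w) ∣[m] g = seed l w},
      fun {a b} ha hb => by
        change (seed l w) ∣[m] (a * b) = seed l w
        rw [SlashAction.slash_mul, show (seed l w) ∣[m] a = seed l w from ha]
        exact hb⟩, SlashAction.slash_one _ _⟩,
      fun {a} ha => by
        change (seed l w) ∣[m] a⁻¹ = seed l w
        conv_lhs => rw [← (show (seed l w) ∣[m] a = seed l w from ha)]
        rw [← SlashAction.slash_mul, mul_inv_cancel, SlashAction.slash_one]⟩ :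
      Subgroup SL(2, ℤ)) := seed_slash_T m l w
  exact (Subgroup.zpowers_le.mpr hT) hg

/-- The summand `(seed ∣_m M)(𝔷)` of the Poincaré series, as a function of the coset `Γ_∞ M`. -/
def poincareTerm (m : ℤ) (l : ℕ) (τ : ℍ) (w : ℂ) : Cosets → ℂ :=
  Quotient.lift (fun M : SL(2, ℤ) => ((seed l w) ∣[m] M) τ) (by
    intro a b hab
    have h : b * a⁻¹ ∈ GammaInf := QuotientGroup.rightRel_apply.mp hab
    have hb : b = (b * a⁻¹) * a := by group
    change ((seed l w) ∣[m] a) τ = ((seed l w) ∣[m] b) τ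
    rw [hb, SlashAction.slash_mul, seed_slash_GammaInf m l w h])

/-- The Poincaré series
`H_{m,ℓ}(𝔷, w) = 2πi ∑_{M ∈ Γ_∞ \ SL₂(ℤ)} (Im(𝔷)^(-ℓ) / (1 - exp(2πi(w - 𝔷)))) ∣_{m,𝔷} M`. -/
def H (m : ℤ) (l : ℕ) (τ : ℍ) (w : ℂ) : ℂ :=
  2 * (Real.pi : ℂ) * Complex.I * ∑' M : Cosets, poincareTerm m l τ w M

/-- `H_{m,ℓ}(𝔷, ·)` is well behaved at `z`: the series converges absolutely at all points near `z`,
and its sum is holomorphic near `z`. -/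
def ConvergesAt (m : ℤ) (l : ℕ) (τ z : ℍ) : Prop :=
  (∀ᶠ w in 𝓝 (z : ℂ), Summable (fun M : Cosets => ‖poincareTerm m l τ w M‖)) ∧
    AnalyticAt ℂ (fun w : ℂ => H m l τ w) (z : ℂ)

/-- `H_{m,ℓ}^{(r)}(𝔷, z)`, the `r`-th complex derivative with respect to the second variable. -/
def HDeriv (r : ℕ) (m : ℤ) (l : ℕ) (τ z : ℍ) : ℂ :=
  iteratedDeriv r (fun w : ℂ => H m l τ w) (z : ℂ)

/-- The completion `Ê₂(τ) = E₂(τ) - 3 / (π Im τ)`. -/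
def E2hat (τ : ℍ) : ℂ := EisensteinSeries.E2 τ - 3 / ((Real.pi : ℂ) * ((τ.im : ℝ) : ℂ))

/-- `𝓕_{m,ℓ}^{(r)}(𝔷, z) = ∑_{j=0}^{ℓ} binom(ℓ,j) (3/π)^{ℓ-j} Ê₂(𝔷)^j H_{m-2j,ℓ-j}^{(r)}(𝔷, z)`. -/
def F (r : ℕ) (m : ℤ) (l : ℕ) (τ z : ℍ) : ℂ :=
  ∑ j ∈ Finset.range (l + 1),
    (l.choose j : ℂ) * (3 / (Real.pi : ℂ)) ^ (l - j) * E2hat τ ^ j *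
      HDeriv r (m - 2 * (j : ℤ)) (l - j) τ z

/-- `∂_z^r (E₂(z)^ℓ H_m(𝔷, z))`. -/
def E2HDeriv (r : ℕ) (m : ℤ) (l : ℕ) (τ z : ℍ) : ℂ :=
  iteratedDeriv r (fun w : ℂ => EisensteinSeries.E2 (ofComplex w) ^ l * H m 0 τ w) (z : ℂ)

/-- `z` is an elliptic (fixed) point of `SL₂(ℤ)`: some matrix other than `±1` fixes it. -/
def IsEllipticPoint (z : ℍ) : Prop := ∃ γ : SL(2, ℤ), γ ≠ 1 ∧ γ ≠ -1 ∧ γ • z = z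

end MeroPoincare

end

/-!
The two Poincaré series to be compared have, summand by summand, the same poles, and these cancel.

The transformation law of `E₂` reads `E₂(Mτ) = (cτ + d)² Ê₂(τ) + 3 / (π Im Mτ)`. Expanding its
`l`-th power by the binomial theorem shows that, before differentiating in `w`, the combination `𝓕`
is the Poincaré series of weight `m` of the seed `E₂(τ)^l / (1 - exp(2πi(w - τ)))`, while
`E₂(w)^l H_m` is that of `E₂(w)^l / (1 - exp(2πi(w - τ)))` (`sum_poincareTerm_sub_eq`). The
difference of the seeds, `(E₂(τ)^l - E₂(w)^l) / (1 - exp(2πi(w - τ)))`, is a divided difference of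
a holomorphic function of `q` on the unit disc, hence holomorphic in `τ` and `w` without exception
(`kernel`), and so is its Poincaré series (`diffSeries`).

Convergence is governed by `k = m - 2l ≥ 4`: since `E₂(Mτ) = O(|cτ + d|²)` uniformly for `Im τ`
bounded below (`exists_norm_E2_smul_le`), the summands are dominated by those of an Eisenstein
series of weight `k`, and they carry a further factor `q_{Mτ}` that makes the terms with `c = 0`
vanish at `i∞` (`exists_norm_kernel_slash_le`). Dominated convergence gives the vanishing of the
whole series at the cusp. The derivatives in `w` inherit invariance trivially, vanishing at the cusp
by Cauchy's estimate, and holomorphy in `τ` by `differentiableOn_iteratedDeriv_right`: for a locally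
bounded, separately holomorphic function the difference quotients in `w` converge locally uniformly
in `τ`.

For the series `H_{m,l}` themselves one needs that the poles `w ∈ Mτ + ℤ` keep a positive distance
from `z`; this holds because `Im Mτ` exceeds a given positive bound for only finitely many cosets
(`exists_nhds_le_norm_qParam_sub`).
-/

noncomputable section

namespace MeroPoincare

open Complex Filter Metric Set
open scoped Manifold
open UpperHalfPlane (denom)

local notation "𝕢" => Function.Periodic.qParam 1

/-! ### Divided differences and derivatives in a parameter -/

lemma dslope_symm (g : ℂ → ℂ) (a b : ℂ) : dslope g a b = dslope g b a := by
  rcases eq_or_ne a b with rfl | h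
  · rfl
  · rw [dslope_of_ne _ h.symm, dslope_of_ne _ h, slope_comm]

/-- A holomorphic function on the unit disc has divided differences `g[p, q]` that grow no faster
than `g q` as `q` approaches the unit circle, uniformly for `p` in a smaller disc. -/
lemma exists_norm_dslope_le {g : ℂ → ℂ} (hg : DifferentiableOn ℂ g (ball 0 1)) {ρ : ℝ}
    (hρ0 : 0 ≤ ρ) (hρ : ρ < 1) :
    ∃ C : ℝ, 0 ≤ C ∧ ∀ p : ℂ, ‖p‖ ≤ ρ → ∀ q : ℂ, ‖q‖ < 1 → ‖dslope g p q‖ ≤ C * (1 + ‖g q‖) := by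
  set R := (1 + ρ) / 2 with hR
  have hRρ : ρ < R := by linarith
  have hR1 : R < 1 := by linarith
  have hsub : closedBall (0 : ℂ) R ⊆ ball 0 1 := closedBall_subset_ball hR1
  obtain ⟨G, hG⟩ := (isCompact_closedBall (0 : ℂ) R).exists_bound_of_continuousOn
    (hg.continuousOn.mono hsub)
  obtain ⟨G', hG'⟩ := (isCompact_closedBall (0 : ℂ) R).exists_bound_of_continuousOn
    ((hg.deriv isOpen_ball).continuousOn.mono hsub)
  have h0 : (0 : ℂ) ∈ closedBall (0 : ℂ) R := by simp; linarith
  have hG0 : 0 ≤ G := (norm_nonneg _).trans (hG 0 h0)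
  have hG'0 : 0 ≤ G' := (norm_nonneg _).trans (hG' 0 h0)
  have hd : 0 < R - ρ := by linarith
  refine ⟨G' + (1 + G) / (R - ρ), by positivity, fun p hp q hq ↦ ?_⟩
  have hpR : p ∈ closedBall (0 : ℂ) R := by simp; linarith
  have hle : (1 : ℝ) ≤ 1 + ‖g q‖ := by linarith [norm_nonneg (g q)]
  have hquot : 0 ≤ (1 + G) / (R - ρ) := by positivity
  by_cases hqR : ‖q‖ ≤ R
  · have hqR' : q ∈ closedBall (0 : ℂ) R := by simpa using hqR
    have key : ‖dslope g p q‖ ≤ G' := by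
      rcases eq_or_ne q p with rfl | hne
      · simpa [dslope_same] using hG' q hqR'
      · have := (convex_closedBall (0 : ℂ) R).norm_image_sub_le_of_norm_deriv_le
          (fun x hx ↦ hg.differentiableAt (isOpen_ball.mem_nhds (hsub hx))) hG' hpR hqR'
        rw [dslope_of_ne _ hne, slope_def_field, norm_div]
        exact div_le_of_le_mul₀ (norm_nonneg _) hG'0 this
    nlinarith
  · push Not at hqR
    have hdist : R - ρ ≤ ‖q - p‖ := by linarith [norm_sub_norm_le q p]
    have hne : q ≠ p := by rintro rfl; simp at hdist; linarith
    rw [dslope_of_ne _ hne, slope_def_field, norm_div]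
    calc ‖g q - g p‖ / ‖q - p‖ ≤ (‖g q‖ + G) / (R - ρ) := by
          gcongr
          exact (norm_sub_le _ _).trans (by gcongr; exact hG p hpR)
      _ ≤ (1 + G) / (R - ρ) * (1 + ‖g q‖) := by
          rw [div_mul_eq_mul_div]
          gcongr
          nlinarith [norm_nonneg (g q)]
      _ ≤ _ := by gcongr; linarith

/-- The error of a difference quotient of a bounded holomorphic function is `O(h)`, with a constant
that depends only on the radius and the bound. -/
lemma norm_dslope_sub_deriv_le {f : ℂ → ℂ} {c : ℂ} {R B : ℝ} (hR : 0 < R)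
    (hf : DifferentiableOn ℂ f (ball c R)) (hB : ∀ x ∈ ball c R, ‖f x‖ ≤ B) {x : ℂ}
    (hx : x ∈ ball c R) : ‖dslope f c x - deriv f c‖ ≤ 4 * B / R / R * dist x c := by
  have hc : ball c R ∈ 𝓝 c := ball_mem_nhds c hR
  have h1 : ∀ y ∈ ball c R, ‖dslope f c y‖ ≤ 2 * B / R := fun y hy ↦
    norm_dslope_le_div_of_mapsTo_ball hf (fun t ht ↦ by
      rw [mem_closedBall, dist_eq_norm]
      linarith [norm_sub_le (f t) (f c), hB t ht, hB c (mem_ball_self hR)]) hy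
  have h2 := dist_le_div_mul_dist_of_mapsTo_ball (R₂ := 4 * B / R)
    ((differentiableOn_dslope hc).mpr hf) (fun t ht ↦ by
      rw [mem_closedBall, dist_eq_norm]
      have := norm_sub_le (dslope f c t) (dslope f c c)
      have h3 := h1 t ht
      have h4 := h1 c (mem_ball_self hR)
      have : 4 * B / R = 2 * B / R + 2 * B / R := by ring
      linarith) hx
  rwa [dslope_same, dist_eq_norm] at h2

/-- Let `D` be locally bounded on `U × V` and holomorphic in each variable separately. Then its
derivative in the second variable is so as well. -/
lemma separately_holomorphic_deriv {U V : Set ℂ} (hU : IsOpen U) (hV : IsOpen V) {D : ℂ → ℂ → ℂ}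
    (h1 : ∀ w ∈ V, DifferentiableOn ℂ (fun τ ↦ D τ w) U)
    (h2 : ∀ τ ∈ U, DifferentiableOn ℂ (D τ) V)
    (h3 : ∀ τ ∈ U, ∀ w ∈ V, ∃ C : ℝ, ∀ᶠ p in 𝓝 (τ, w), ‖D p.1 p.2‖ ≤ C) :
    (∀ w ∈ V, DifferentiableOn ℂ (fun τ ↦ deriv (D τ) w) U) ∧
      (∀ τ ∈ U, DifferentiableOn ℂ (deriv (D τ)) V) ∧
      ∀ τ ∈ U, ∀ w ∈ V, ∃ C : ℝ, ∀ᶠ p in 𝓝 (τ, w), ‖deriv (D p.1) p.2‖ ≤ C := by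
  have h3' : ∀ τ ∈ U, ∀ w ∈ V, ∃ C ε : ℝ, 0 < ε ∧ ball τ ε ⊆ U ∧ ball w ε ⊆ V ∧
      ∀ t ∈ ball τ ε, ∀ v ∈ ball w ε, ‖D t v‖ ≤ C := by
    intro τ hτ w hw
    obtain ⟨C, hC⟩ := h3 τ hτ w hw
    have hm := hC.and (((hU.prod hV).mem_nhds (show (τ, w) ∈ U ×ˢ V from ⟨hτ, hw⟩)))
    obtain ⟨ε, hε, hball⟩ := Metric.eventually_nhds_iff_ball.mp hm
    have hmem : ∀ t ∈ ball τ ε, ∀ v ∈ ball w ε, (t, v) ∈ ball (τ, w) ε := fun t ht v hv ↦ by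
      rw [← ball_prod_same]; exact ⟨ht, hv⟩
    exact ⟨C, ε, hε, fun t ht ↦ (hball _ (hmem t ht w (mem_ball_self hε))).2.1,
      fun v hv ↦ (hball _ (hmem τ (mem_ball_self hε) v hv)).2.2,
      fun t ht v hv ↦ (hball _ (hmem t ht v hv)).1⟩
  refine ⟨fun w hw ↦ ?_, fun τ hτ ↦ (h2 τ hτ).deriv hV, fun τ hτ w hw ↦ ?_⟩
  · have hlim : TendstoLocallyUniformlyOn (fun x τ ↦ dslope (D τ) w x)
        (fun τ ↦ deriv (D τ) w) (𝓝[≠] w) U := by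
      rw [Metric.tendstoLocallyUniformlyOn_iff]
      intro η hη τ hτ
      obtain ⟨C, ε, hε, hεU, hεV, hC⟩ := h3' τ hτ w hw
      refine ⟨ball τ ε, mem_nhdsWithin_of_mem_nhds (ball_mem_nhds _ hε), ?_⟩
      have hcont : Tendsto (fun x ↦ 4 * C / ε / ε * dist x w) (𝓝 w) (𝓝 0) := by
        have : Continuous (fun x ↦ 4 * C / ε / ε * dist x w) := by fun_prop
        simpa using this.tendsto w
      filter_upwards [mem_nhdsWithin_of_mem_nhds (hcont.eventually_lt_const hη),
        mem_nhdsWithin_of_mem_nhds (ball_mem_nhds w hε)] with x hx hxε t ht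
      rw [dist_comm, dist_eq_norm]
      exact (norm_dslope_sub_deriv_le hε ((h2 t (hεU ht)).mono hεV) (hC t ht) hxε).trans_lt hx
    refine hlim.differentiableOn ?_ hU
    filter_upwards [self_mem_nhdsWithin, mem_nhdsWithin_of_mem_nhds (hV.mem_nhds hw)] with x hx hxV
    simp_rw [dslope_of_ne _ hx, slope_def_field]
    exact ((h1 x hxV).sub (h1 w hw)).div_const _
  · obtain ⟨C, ε, hε, hεU, hεV, hC⟩ := h3' τ hτ w hw
    refine ⟨C / (ε / 2), ?_⟩
    have : ball τ ε ×ˢ ball w (ε / 2) ∈ 𝓝 (τ, w) :=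
      prod_mem_nhds (ball_mem_nhds _ hε) (ball_mem_nhds _ (by positivity))
    filter_upwards [this] with p hp
    have hsub : closedBall p.2 (ε / 2) ⊆ ball w ε := fun x hx ↦ by
      have := mem_ball.mp hp.2
      have := mem_closedBall.mp hx
      have := dist_triangle x p.2 w
      rw [mem_ball]; linarith
    refine norm_deriv_le_of_forall_mem_sphere_norm_le (by positivity) ?_ fun x hx ↦
      hC _ hp.1 _ (hsub (sphere_subset_closedBall hx))
    refine DifferentiableOn.diffContOnCl_ball (U := ball w ε) ?_ hsub
    exact (h2 _ (hεU hp.1)).mono hεV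

/-- Let `D` be locally bounded on `U × V` and holomorphic in each variable separately. Then all its
derivatives in the second variable are holomorphic in the first. -/
lemma differentiableOn_iteratedDeriv_right {U V : Set ℂ} (hU : IsOpen U) (hV : IsOpen V) (r : ℕ) :
    ∀ {D : ℂ → ℂ → ℂ},
    (∀ w ∈ V, DifferentiableOn ℂ (fun τ ↦ D τ w) U) → (∀ τ ∈ U, DifferentiableOn ℂ (D τ) V) →
    (∀ τ ∈ U, ∀ w ∈ V, ∃ C : ℝ, ∀ᶠ p in 𝓝 (τ, w), ‖D p.1 p.2‖ ≤ C) → ∀ w ∈ V,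
    DifferentiableOn ℂ (fun τ ↦ iteratedDeriv r (D τ) w) U := by
  induction r with
  | zero => intro D h1 _ _ w hw; simpa using h1 w hw
  | succ r ih =>
    intro D h1 h2 h3 w hw
    obtain ⟨h1', h2', h3'⟩ := separately_holomorphic_deriv hU hV h1 h2 h3
    simp_rw [iteratedDeriv_succ']
    exact ih h1' h2' h3' w hw

/-! ### Cosets of `Γ_∞` and Poincaré series -/

lemma mem_GammaInf_of_row {g : SL(2, ℤ)} (h0 : g 1 0 = 0) (h1 : g 1 1 = 1) : g ∈ GammaInf := by
  have hdet := g.det_coe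
  rw [Matrix.det_fin_two, h0, h1] at hdet
  have h00 : g 0 0 = 1 := by linarith
  refine Subgroup.mem_zpowers_iff.mpr ⟨g 0 1, ?_⟩
  ext i j
  rw [ModularGroup.coe_T_zpow]
  fin_cases i <;> fin_cases j <;> simp [h0, h1, h00]

/-- The bottom row `(c, d)` of a representative of the coset `M`; it does not depend on the
representative. -/
def bottomRow (M : Cosets) : Fin 2 → ℤ := ![M.out 1 0, M.out 1 1]

lemma bottomRow_injective : Function.Injective bottomRow := by
  intro M N h
  have h0 : M.out 1 0 = N.out 1 0 := congrFun h 0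
  have h1 : M.out 1 1 = N.out 1 1 := congrFun h 1
  rw [← Quotient.out_equiv_out]
  refine QuotientGroup.rightRel_apply.mpr (mem_GammaInf_of_row ?_ ?_)
  · simp [Matrix.SpecialLinearGroup.coe_inv, Matrix.adjugate_fin_two, Matrix.mul_apply, h0, h1]
    ring
  · have hdet := M.out.det_coe
    rw [Matrix.det_fin_two] at hdet
    simp [Matrix.SpecialLinearGroup.coe_inv, Matrix.adjugate_fin_two, Matrix.mul_apply, ← h0, ← h1]
    linarith

lemma bottomRow_ne_zero (M : Cosets) : bottomRow M ≠ 0 := by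
  intro h
  have h0 : M.out 1 0 = 0 := congrFun h 0
  have h1 : M.out 1 1 = 0 := congrFun h 1
  have hdet := M.out.det_coe
  rw [Matrix.det_fin_two, h0, h1] at hdet
  simp at hdet

lemma one_le_norm_bottomRow (M : Cosets) : 1 ≤ ‖bottomRow M‖ := by
  have h : ‖bottomRow M‖ ≠ 0 := norm_ne_zero_iff.mpr (bottomRow_ne_zero M)
  rw [EisensteinSeries.norm_eq_max_natAbs] at h ⊢
  exact_mod_cast Nat.one_le_iff_ne_zero.mpr (by exact_mod_cast h)

/-- Distinct cosets have distinct bottom rows, so the sum is part of the Eisenstein sum over `ℤ²`. -/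
lemma summable_norm_bottomRow {k : ℕ} (hk : 3 ≤ k) :
    Summable fun M : Cosets ↦ (‖bottomRow M‖ ^ k)⁻¹ := by
  have h := (EisensteinSeries.summable_one_div_norm_rpow (k := k)
    (by exact_mod_cast hk)).comp_injective bottomRow_injective
  refine h.congr fun M ↦ ?_
  simp [Function.comp, Real.rpow_neg]

/-- On a vertical strip, `|cτ + d|` is comparable from below to `max(|c|, |d|)`. -/
lemma exists_mul_norm_bottomRow_le (A : ℝ) {B : ℝ} (hB : 0 < B) :
    ∃ ρ : ℝ, 0 < ρ ∧ ∀ τ ∈ UpperHalfPlane.verticalStrip A B, ∀ M : Cosets,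
      ρ * ‖bottomRow M‖ ≤ ‖denom M.out τ‖ := by
  refine ⟨EisensteinSeries.r ⟨⟨A, B⟩, hB⟩, EisensteinSeries.r_pos _, fun τ hτ M ↦ ?_⟩
  have h := EisensteinSeries.r_mul_max_le τ (bottomRow_ne_zero M)
  rw [ModularGroup.denom_apply]
  refine (mul_le_mul_of_nonneg_right
    (EisensteinSeries.r_lower_bound_on_verticalStrip τ hB hτ) (norm_nonneg _)).trans ?_
  simpa [bottomRow] using h

lemma inv_norm_denom_pow_le {ρ : ℝ} (hρ : 0 < ρ) {M : Cosets} {τ : ℍ}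
    (h : ρ * ‖bottomRow M‖ ≤ ‖denom M.out τ‖) (k : ℕ) :
    (‖denom M.out τ‖ ^ k)⁻¹ ≤ (ρ ^ k)⁻¹ * (‖bottomRow M‖ ^ k)⁻¹ := by
  have h1 := one_le_norm_bottomRow M
  rw [← mul_inv, ← mul_pow]
  gcongr

lemma summable_norm_denom {k : ℕ} (hk : 3 ≤ k) (τ : ℍ) :
    Summable fun M : Cosets ↦ (‖denom M.out τ‖ ^ k)⁻¹ := by
  obtain ⟨ρ, hρ, h⟩ := exists_mul_norm_bottomRow_le |τ.re| τ.im_pos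
  exact ((summable_norm_bottomRow hk).mul_left (ρ ^ k)⁻¹).of_nonneg_of_le (fun M ↦ by positivity)
    fun M ↦ inv_norm_denom_pow_le hρ (h τ ⟨le_rfl, le_rfl⟩ M) k

/-- Right multiplication by `γ` on `Γ_∞ \ SL₂(ℤ)`. -/
def mulRightCosets (γ : SL(2, ℤ)) : Cosets ≃ Cosets :=
  Quotient.congr (Equiv.mulRight γ) fun a b ↦ by
    simp [QuotientGroup.rightRel_apply, mul_assoc]

lemma slash_eq_of_mem_GammaInf {m : ℤ} {f : ℍ → ℂ} (hf : f ∣[m] ModularGroup.T = f)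
    {g : SL(2, ℤ)} (hg : g ∈ GammaInf) : f ∣[m] g = f := by
  rw [GammaInf, Subgroup.zpowers_eq_closure] at hg
  induction hg using Subgroup.closure_induction with
  | mem x hx => rw [mem_singleton_iff.mp hx, hf]
  | one => exact SlashAction.slash_one _ _
  | mul a b _ _ ha hb => rw [SlashAction.slash_mul, ha, hb]
  | inv a _ ha =>
    conv_lhs => rw [← ha]
    rw [← SlashAction.slash_mul, mul_inv_cancel, SlashAction.slash_one]

/-- The summands of `poincareSeries` do not depend on the chosen representatives. -/
lemma slash_out {m : ℤ} {f : ℍ → ℂ} (hf : f ∣[m] ModularGroup.T = f) (g : SL(2, ℤ)) :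
    f ∣[m] (Quotient.mk (QuotientGroup.rightRel GammaInf) g).out = f ∣[m] g := by
  have h := QuotientGroup.rightRel_apply.mp
    (Quotient.mk_out (s := QuotientGroup.rightRel GammaInf) g)
  have h' := slash_eq_of_mem_GammaInf hf h
  conv_lhs => rw [← h']
  rw [← SlashAction.slash_mul]
  congr 1
  group

/-- The Poincaré series `∑_{M ∈ Γ_∞ \ SL₂(ℤ)} f ∣_m M`. It is built from arbitrary representatives
of the cosets, which is harmless for seeds `f` with `f ∣_m T = f`. -/
def poincareSeries (m : ℤ) (f : ℍ → ℂ) (τ : ℍ) : ℂ := ∑' M : Cosets, (f ∣[m] M.out) τ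

/-- Right multiplication by `γ` permutes the summands. -/
lemma poincareSeries_slash {m : ℤ} {f : ℍ → ℂ} (hf : f ∣[m] ModularGroup.T = f) (γ : SL(2, ℤ)) :
    poincareSeries m f ∣[m] γ = poincareSeries m f := by
  ext τ
  rw [ModularForm.SL_slash_apply, poincareSeries, ← tsum_mul_right, poincareSeries,
    ← (mulRightCosets γ).tsum_eq (fun M ↦ (f ∣[m] M.out) τ)]
  refine tsum_congr fun M ↦ ?_
  rw [← ModularForm.SL_slash_apply, ← SlashAction.slash_mul, ← slash_out hf]
  conv_rhs => rw [← M.out_eq]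
  rfl

/-! ### The Eisenstein series `E₂` -/

/-- `E₂` as a holomorphic function of `q = exp(2πiτ)` on the unit disc. -/
def E2disc : ℂ → ℂ := UpperHalfPlane.cuspFunction 1 EisensteinSeries.E2

lemma periodic_E2 : Function.Periodic (EisensteinSeries.E2 ∘ ofComplex) ((1 : ℝ) : ℂ) := by
  intro w
  by_cases! hw : 0 < w.im
  · have hw' : 0 < (w + (1 : ℝ)).im := by simpa using hw
    simp only [Function.comp_apply, UpperHalfPlane.ofComplex_apply_of_im_pos hw,
      UpperHalfPlane.ofComplex_apply_of_im_pos hw', EisensteinSeries.E2_eq_tsum_cexp]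
    simp [mul_add, Complex.exp_add]
  · have hw' : (w + (1 : ℝ)).im ≤ 0 := by simpa using hw
    rw [Function.comp_apply, Function.comp_apply, UpperHalfPlane.ofComplex_apply_of_im_nonpos hw,
      UpperHalfPlane.ofComplex_apply_of_im_nonpos hw']

lemma E2disc_qParam (τ : ℍ) : E2disc (𝕢 τ) = EisensteinSeries.E2 τ :=
  UpperHalfPlane.eq_cuspFunction τ one_ne_zero periodic_E2

lemma differentiableOn_E2disc : DifferentiableOn ℂ E2disc (ball 0 1) :=
  UpperHalfPlane.differentiableOn_cuspFunction_ball one_pos periodic_E2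
    E2_mdifferentiable EisensteinSeries.isBoundedAtImInfty_E2

lemma norm_qParam_eq (z : ℂ) : ‖𝕢 z‖ = Real.exp (-2 * Real.pi * z.im) := by
  simpa using Function.Periodic.norm_qParam 1 z

lemma norm_qParam_lt_one (τ : ℍ) : ‖𝕢 τ‖ < 1 :=
  Function.Periodic.norm_qParam_lt_one one_pos τ.im_pos

lemma norm_qParam_le {B : ℝ} {z : ℂ} (h : B ≤ z.im) :
    ‖𝕢 z‖ ≤ Real.exp (-2 * Real.pi * B) := by
  rw [norm_qParam_eq]
  exact Real.exp_le_exp.mpr (mul_le_mul_of_nonpos_left h (by linarith [Real.pi_pos]))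

lemma exp_neg_two_pi_mul_lt_one {B : ℝ} (hB : 0 < B) : Real.exp (-2 * Real.pi * B) < 1 := by
  rw [Real.exp_lt_one_iff]
  nlinarith [mul_pos Real.pi_pos hB]

lemma E2_smul (γ : SL(2, ℤ)) (τ : ℍ) :
    EisensteinSeries.E2 (γ • τ) = denom γ τ ^ 2 *
      (EisensteinSeries.E2 τ - 6 * I / Real.pi * (γ 1 0 / denom γ τ)) := by
  have h := congrFun (EisensteinSeries.E2_slash_action γ) τ
  have hd : denom γ τ ≠ 0 := UpperHalfPlane.denom_ne_zero γ τ
  rw [ModularForm.SL_slash_apply] at h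
  simp only [Pi.sub_apply, Pi.smul_apply, smul_eq_mul, EisensteinSeries.D2, riemannZeta_two] at h
  rw [zpow_neg, mul_inv_eq_iff_eq_mul₀ (zpow_ne_zero _ hd)] at h
  rw [h, mul_comm]
  have hpi : (Real.pi : ℂ) ≠ 0 := by exact_mod_cast Real.pi_ne_zero
  generalize denom γ τ = j at *
  field_simp

lemma abs_mul_im_le_norm_denom (γ : SL(2, ℤ)) (τ : ℍ) :
    |(γ 1 0 : ℝ)| * τ.im ≤ ‖denom γ τ‖ := by
  have h : (denom γ τ).im = γ 1 0 * τ.im := by simp [ModularGroup.denom_apply]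
  have := abs_im_le_norm (denom γ τ)
  rwa [h, abs_mul, abs_of_pos τ.im_pos] at this

/-- `E₂` grows like a form of weight `2` along orbits, uniformly in a half-plane `Im τ ≥ B`. -/
lemma exists_norm_E2_smul_le {B : ℝ} (hB : 0 < B) :
    ∃ C : ℝ, 0 ≤ C ∧ ∀ τ : ℍ, B ≤ τ.im → ∀ γ : SL(2, ℤ),
      ‖EisensteinSeries.E2 (γ • τ)‖ ≤ C * ‖denom γ τ‖ ^ 2 := by
  obtain ⟨G, hG⟩ := (isCompact_closedBall (0 : ℂ)
    (Real.exp (-2 * Real.pi * B))).exists_bound_of_continuousOn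
    (differentiableOn_E2disc.continuousOn.mono
      (closedBall_subset_ball (exp_neg_two_pi_mul_lt_one hB)))
  have hG0 : 0 ≤ G := (norm_nonneg _).trans (hG 0 (by simp; positivity))
  refine ⟨G + 6 / Real.pi * (1 / B), by positivity, fun τ hτ γ ↦ ?_⟩
  have hd : 0 < ‖denom γ τ‖ := norm_pos_iff.mpr (UpperHalfPlane.denom_ne_zero γ τ)
  rw [E2_smul, norm_mul, norm_pow, mul_comm]
  gcongr
  refine (norm_sub_le _ _).trans (add_le_add ?_ ?_)
  · rw [← E2disc_qParam]
    exact hG _ (by simpa using norm_qParam_le hτ)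
  · have : ‖(γ 1 0 : ℂ) / denom γ τ‖ ≤ 1 / B := by
      rw [norm_div, div_le_div_iff₀ hd hB, one_mul, Complex.norm_intCast]
      exact (mul_le_mul_of_nonneg_left hτ (abs_nonneg _)).trans (abs_mul_im_le_norm_denom γ τ)
    rw [norm_mul]
    gcongr
    simp [abs_of_pos Real.pi_pos]

/-- The transformation law of `E₂`, through the completion `Ê₂` at the original point and the
imaginary part at the image point. -/
lemma E2_smul_eq_E2hat (γ : SL(2, ℤ)) (τ : ℍ) :
    EisensteinSeries.E2 (γ • τ) =
      denom γ τ ^ 2 * E2hat τ + 3 / Real.pi * (((γ • τ).im : ℝ) : ℂ)⁻¹ := by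
  have hd : denom γ τ ≠ 0 := UpperHalfPlane.denom_ne_zero γ τ
  have hpi : (Real.pi : ℂ) ≠ 0 := by exact_mod_cast Real.pi_ne_zero
  have hy : ((τ.im : ℝ) : ℂ) ≠ 0 := by exact_mod_cast τ.im_ne_zero
  have hj : denom γ τ - (starRingEnd ℂ) (denom γ τ) = 2 * I * (γ 1 0 * τ.im) := by
    rw [Complex.sub_conj]
    have h : (denom γ τ).im = γ 1 0 * τ.im := by simp [ModularGroup.denom_apply]
    rw [h]; push_cast; ring
  rw [E2_smul, E2hat, ModularGroup.im_smul_eq_div_normSq]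
  push_cast
  rw [Complex.normSq_eq_conj_mul_self, inv_div]
  rw [← sub_sub_self (denom γ τ) ((starRingEnd ℂ) (denom γ τ)), hj]
  field_simp
  ring

/-! ### The holomorphic seed -/

/-- The seed `τ ↦ q_τ (g(q_τ) - g(q_w)) / (q_τ - q_w)`, extended holomorphically across
`q_τ = q_w`. With `f(τ) = g(q_τ)` it is `(f(τ) - f(w)) / (1 - exp(2πi(w - τ)))`. -/
def kernel (g : ℂ → ℂ) (w : ℂ) (τ : ℍ) : ℂ := 𝕢 τ * dslope g (𝕢 w) (𝕢 τ)

/-- A function of `q` is `1`-periodic in `τ`. -/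
lemma kernel_slash_T (m : ℤ) (g : ℂ → ℂ) (w : ℂ) :
    kernel g w ∣[m] ModularGroup.T = kernel g w := by
  ext τ
  have h1 : denom (ModularGroup.T : SL(2, ℤ)) τ = 1 := by
    rw [ModularGroup.denom_apply]; simp [ModularGroup.T]
  have h2 : 𝕢 (ModularGroup.T • τ : ℍ) = 𝕢 τ := by
    rw [UpperHalfPlane.modular_T_smul, UpperHalfPlane.coe_vadd]
    simp [Function.Periodic.qParam, mul_add, Complex.exp_add]
  rw [ModularForm.SL_slash_apply, h1, kernel, h2, kernel, one_zpow, mul_one]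

lemma one_sub_exp_eq (w : ℂ) (τ : ℂ) :
    1 - Complex.exp (2 * (Real.pi : ℂ) * I * (w - τ)) = (𝕢 τ - 𝕢 w) / 𝕢 τ := by
  rw [sub_div, div_self (Function.Periodic.qParam_ne_zero τ), mul_sub, Complex.exp_sub]
  simp [Function.Periodic.qParam]

lemma kernel_of_ne {g : ℂ → ℂ} {w : ℂ} {τ : ℍ} (h : 𝕢 τ ≠ 𝕢 w) :
    kernel g w τ =
      (g (𝕢 τ) - g (𝕢 w)) / (1 - Complex.exp (2 * (Real.pi : ℂ) * I * (w - τ))) := by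
  rw [one_sub_exp_eq, kernel, dslope_of_ne _ h, slope_def_field, div_div_eq_mul_div]
  ring

lemma differentiableOn_kernel_left {g : ℂ → ℂ} (hg : DifferentiableOn ℂ g (ball 0 1)) (τ : ℍ) :
    DifferentiableOn ℂ (fun w ↦ kernel g w τ) {w | 0 < w.im} := by
  simp_rw [kernel, dslope_symm g _ (𝕢 τ)]
  refine DifferentiableOn.const_mul ?_ _
  have hτ : ball (0 : ℂ) 1 ∈ 𝓝 (𝕢 τ) :=
    isOpen_ball.mem_nhds (by simpa using norm_qParam_lt_one τ)
  refine ((differentiableOn_dslope hτ).mpr hg).comp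
    Function.Periodic.differentiable_qParam.differentiableOn fun w hw ↦ ?_
  simpa using norm_qParam_lt_one ⟨w, hw⟩

lemma mdifferentiable_kernel {g : ℂ → ℂ} (hg : DifferentiableOn ℂ g (ball 0 1)) {w : ℂ}
    (hw : 0 < w.im) : MDiff (kernel g w) := by
  rw [UpperHalfPlane.mdifferentiable_iff]
  have hw' : ball (0 : ℂ) 1 ∈ 𝓝 (𝕢 w) :=
    isOpen_ball.mem_nhds (by simpa using norm_qParam_lt_one ⟨w, hw⟩)
  have h : DifferentiableOn ℂ (fun τ ↦ 𝕢 τ * dslope g (𝕢 w) (𝕢 τ)) {τ | 0 < τ.im} := by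
    refine Function.Periodic.differentiable_qParam.differentiableOn.mul
      (((differentiableOn_dslope hw').mpr hg).comp
        Function.Periodic.differentiable_qParam.differentiableOn fun τ hτ ↦ ?_)
    simpa using norm_qParam_lt_one ⟨τ, hτ⟩
  refine h.congr fun τ hτ ↦ ?_
  simp [kernel, UpperHalfPlane.ofComplex_apply_of_im_pos hτ]

/-! ### The holomorphic Poincaré series -/

lemma differentiableOn_E2disc_pow (l : ℕ) :
    DifferentiableOn ℂ (fun q ↦ E2disc q ^ l) (ball 0 1) := differentiableOn_E2disc.pow l

/-- The Poincaré series of weight `k + 2l` of `(E₂(τ)^l - E₂(w)^l) / (1 - exp(2πi(w - τ)))`. -/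
def diffSeries (k l : ℕ) (τ : ℍ) (w : ℂ) : ℂ :=
  poincareSeries (k + 2 * l : ℕ) (kernel (fun q ↦ E2disc q ^ l) w) τ

/-- The summands of the holomorphic Poincaré series are dominated by those of an Eisenstein series
of weight `k`: the factor `E₂(Mτ)^l` costs `|cτ + d|^(2l)`. The factor `q_{Mτ}` is kept since it
makes the summands with `c = 0` decay. -/
lemma exists_norm_kernel_slash_le (k l : ℕ) (A : ℝ) {B : ℝ} (hB : 0 < B) {ρ : ℝ} (hρ0 : 0 ≤ ρ)
    (hρ : ρ < 1) : ∃ C : ℝ, 0 ≤ C ∧ ∀ τ ∈ UpperHalfPlane.verticalStrip A B, ∀ w : ℂ, ‖𝕢 w‖ ≤ ρ →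
      ∀ M : Cosets, ‖(kernel (fun q ↦ E2disc q ^ l) w ∣[((k + 2 * l : ℕ) : ℤ)] M.out) τ‖ ≤
        C * (‖𝕢 (M.out • τ : ℍ)‖ * (‖denom M.out τ‖ ^ k)⁻¹) := by
  obtain ⟨C₁, hC₁, h₁⟩ := exists_norm_dslope_le (differentiableOn_E2disc_pow l) hρ0 hρ
  obtain ⟨C₂, hC₂, h₂⟩ := exists_norm_E2_smul_le hB
  obtain ⟨s, hs, h₃⟩ := exists_mul_norm_bottomRow_le A hB
  refine ⟨C₁ * ((s ^ (2 * l))⁻¹ + C₂ ^ l), by positivity, fun τ hτ w hw M ↦ ?_⟩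
  have hj : 0 < ‖denom M.out τ‖ := norm_pos_iff.mpr (UpperHalfPlane.denom_ne_zero M.out τ)
  have hsj : s ≤ ‖denom M.out τ‖ :=
    (le_mul_of_one_le_right hs.le (one_le_norm_bottomRow M)).trans (h₃ τ hτ M)
  have hE : 1 + ‖E2disc (𝕢 (M.out • τ : ℍ)) ^ l‖ ≤
      ((s ^ (2 * l))⁻¹ + C₂ ^ l) * ‖denom M.out τ‖ ^ (2 * l) := by
    rw [add_mul]
    gcongr
    · rw [inv_mul_eq_div, one_le_div (by positivity)]
      gcongr
    · rw [norm_pow, E2disc_qParam, pow_mul, ← mul_pow]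
      gcongr
      exact h₂ τ hτ.2 M.out
  rw [ModularForm.SL_slash_apply, norm_mul, zpow_neg, zpow_natCast, norm_inv, norm_pow, kernel,
    norm_mul]
  calc _ ≤ ‖𝕢 (M.out • τ : ℍ)‖ * (C₁ * (((s ^ (2 * l))⁻¹ + C₂ ^ l) *
        ‖denom M.out τ‖ ^ (2 * l))) * (‖denom M.out τ‖ ^ (k + 2 * l))⁻¹ := by
        gcongr
        exact (h₁ _ hw _ (norm_qParam_lt_one _)).trans (by gcongr)
    _ = _ := by rw [pow_add]; field_simp

lemma norm_qParam_mul_inv_denom_le {s : ℝ} (hs : 0 < s) {M : Cosets} {τ : ℍ}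
    (h : s * ‖bottomRow M‖ ≤ ‖denom M.out τ‖) (k : ℕ) :
    ‖𝕢 (M.out • τ : ℍ)‖ * (‖denom M.out τ‖ ^ k)⁻¹ ≤ (s ^ k)⁻¹ * (‖bottomRow M‖ ^ k)⁻¹ :=
  (mul_le_of_le_one_left (by positivity) (norm_qParam_lt_one _).le).trans
    (inv_norm_denom_pow_le hs h k)

lemma exists_summable_norm_kernel_slash_le {k : ℕ} (hk : 3 ≤ k) (l : ℕ) (A : ℝ) {B : ℝ}
    (hB : 0 < B) {ρ : ℝ} (hρ0 : 0 ≤ ρ) (hρ : ρ < 1) :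
    ∃ u : Cosets → ℝ, Summable u ∧ ∀ τ ∈ UpperHalfPlane.verticalStrip A B, ∀ w : ℂ, ‖𝕢 w‖ ≤ ρ →
      ∀ M : Cosets, ‖(kernel (fun q ↦ E2disc q ^ l) w ∣[((k + 2 * l : ℕ) : ℤ)] M.out) τ‖ ≤ u M := by
  obtain ⟨C, hC, h⟩ := exists_norm_kernel_slash_le k l A hB hρ0 hρ
  obtain ⟨s, hs, h'⟩ := exists_mul_norm_bottomRow_le A hB
  refine ⟨_, ((summable_norm_bottomRow hk).mul_left (s ^ k)⁻¹).mul_left C, fun τ hτ w hw M ↦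
    (h τ hτ w hw M).trans ?_⟩
  exact mul_le_mul_of_nonneg_left (norm_qParam_mul_inv_denom_le hs (h' τ hτ M) k) hC

/-- A neighbourhood of a point of `ℍ × ℍ` on which the summands have a common majorant. -/
lemma exists_nhds_strip (τ₀ w₀ : ℍ) : ∃ A B ρ : ℝ, 0 < B ∧ 0 ≤ ρ ∧ ρ < 1 ∧
    ∃ U V : Set ℂ, IsOpen U ∧ IsOpen V ∧ (τ₀ : ℂ) ∈ U ∧ (w₀ : ℂ) ∈ V ∧ U ⊆ {τ | 0 < τ.im} ∧
      V ⊆ {w | 0 < w.im} ∧ (∀ τ ∈ U, ofComplex τ ∈ UpperHalfPlane.verticalStrip A B) ∧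
        ∀ w ∈ V, ‖𝕢 w‖ ≤ ρ := by
  have hτ := τ₀.im_pos
  have hw := w₀.im_pos
  refine ⟨|τ₀.re| + 1, τ₀.im / 2, Real.exp (-2 * Real.pi * (w₀.im / 2)), by positivity,
    by positivity, exp_neg_two_pi_mul_lt_one (by positivity),
    {τ | |τ.re| < |τ₀.re| + 1 ∧ τ₀.im / 2 < τ.im}, {w | w₀.im / 2 < w.im}, ?_, ?_, ?_, ?_, ?_,
    ?_, ?_, ?_⟩
  · exact (isOpen_lt (continuous_abs.comp continuous_re) continuous_const).inter
      (isOpen_lt continuous_const continuous_im)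
  · exact isOpen_lt continuous_const continuous_im
  · simp [hτ]
  · simp [hw]
  · rintro τ ⟨_, h⟩
    exact (by positivity : 0 < τ₀.im / 2).trans h
  · intro w h
    exact (by positivity : 0 < w₀.im / 2).trans h
  · rintro τ ⟨h1, h2⟩
    have h : 0 < τ.im := (by positivity : 0 < τ₀.im / 2).trans h2
    rw [UpperHalfPlane.ofComplex_apply_of_im_pos h]
    exact ⟨h1.le, h2.le⟩
  · intro w h
    exact norm_qParam_le (le_of_lt h)

lemma differentiableOn_diffSeries_left {k : ℕ} (hk : 3 ≤ k) (l : ℕ) {w : ℂ} (hw : 0 < w.im) :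
    DifferentiableOn ℂ (fun τ ↦ diffSeries k l (ofComplex τ) w) {τ | 0 < τ.im} := by
  intro τ₀ hτ₀
  obtain ⟨A, B, ρ, hB, hρ0, hρ, U, V, hU, -, hτU, hwV, hU', -, hUs, hVs⟩ :=
    exists_nhds_strip ⟨τ₀, hτ₀⟩ ⟨w, hw⟩
  obtain ⟨u, hu, hle⟩ := exists_summable_norm_kernel_slash_le hk l A hB hρ0 hρ
  have hd : ∀ M : Cosets, MDiff (kernel (fun q ↦ E2disc q ^ l) w ∣[((k + 2 * l : ℕ) : ℤ)] M.out) :=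
    fun M ↦ (mdifferentiable_kernel (differentiableOn_E2disc_pow l) hw).slash _ _
  have := differentiableOn_tsum_of_summable_norm hu
    (fun M ↦ (UpperHalfPlane.mdifferentiable_iff.mp (hd M)).mono hU') hU
    (fun M τ hτ ↦ hle _ (hUs τ hτ) w (hVs w hwV) M)
  exact (this.differentiableAt (hU.mem_nhds hτU)).differentiableWithinAt

lemma differentiableOn_diffSeries_right {k : ℕ} (hk : 3 ≤ k) (l : ℕ) (τ : ℍ) :
    DifferentiableOn ℂ (diffSeries k l τ) {w | 0 < w.im} := by
  intro w₀ hw₀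
  obtain ⟨A, B, ρ, hB, hρ0, hρ, U, V, -, hV, hτU, hwV, -, hV', hUs, hVs⟩ :=
    exists_nhds_strip τ ⟨w₀, hw₀⟩
  obtain ⟨u, hu, hle⟩ := exists_summable_norm_kernel_slash_le hk l A hB hρ0 hρ
  have hτ : τ ∈ UpperHalfPlane.verticalStrip A B := by simpa using hUs _ hτU
  have := differentiableOn_tsum_of_summable_norm hu (U := V)
    (F := fun M w ↦ (kernel (fun q ↦ E2disc q ^ l) w ∣[((k + 2 * l : ℕ) : ℤ)] M.out) τ)
    (fun M ↦ by
      simp_rw [ModularForm.SL_slash_apply]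
      exact ((differentiableOn_kernel_left (differentiableOn_E2disc_pow l) _).mono hV').mul_const _)
    hV (fun M w hw ↦ hle _ hτ w (hVs w hw) M)
  exact (this.differentiableAt (hV.mem_nhds hwV)).differentiableWithinAt

lemma exists_eventually_norm_diffSeries_le {k : ℕ} (hk : 3 ≤ k) (l : ℕ) (τ₀ w₀ : ℍ) :
    ∃ C : ℝ, ∀ᶠ p in 𝓝 ((τ₀ : ℂ), (w₀ : ℂ)), ‖diffSeries k l (ofComplex p.1) p.2‖ ≤ C := by
  obtain ⟨A, B, ρ, hB, hρ0, hρ, U, V, hU, hV, hτU, hwV, -, -, hUs, hVs⟩ :=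
    exists_nhds_strip τ₀ w₀
  obtain ⟨u, hu, hle⟩ := exists_summable_norm_kernel_slash_le hk l A hB hρ0 hρ
  refine ⟨∑' M, u M, ?_⟩
  filter_upwards [prod_mem_nhds (hU.mem_nhds hτU) (hV.mem_nhds hwV)] with p hp
  exact tsum_of_norm_bounded hu.hasSum fun M ↦ hle _ (hUs _ hp.1) _ (hVs _ hp.2) M

lemma diffSeries_smul (k l : ℕ) (γ : SL(2, ℤ)) (τ : ℍ) (w : ℂ) :
    diffSeries k l (γ • τ) w = denom γ τ ^ (k + 2 * l) * diffSeries k l τ w := by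
  have h := congrFun (poincareSeries_slash
    (kernel_slash_T (k + 2 * l : ℕ) (fun q ↦ E2disc q ^ l) w) γ) τ
  have hd : denom γ τ ≠ 0 := UpperHalfPlane.denom_ne_zero γ τ
  rw [ModularForm.SL_slash_apply, zpow_neg, zpow_natCast, mul_inv_eq_iff_eq_mul₀
    (pow_ne_zero _ hd)] at h
  rw [diffSeries, h, mul_comm, diffSeries]

lemma diffSeries_T_zpow_smul (k l : ℕ) (n : ℤ) (τ : ℍ) :
    diffSeries k l (ModularGroup.T ^ n • τ) = diffSeries k l τ := by
  funext w
  have h : denom (ModularGroup.T ^ n : SL(2, ℤ)) τ = 1 := by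
    rw [ModularGroup.denom_apply, ModularGroup.coe_T_zpow]; simp
  rw [diffSeries_smul, h, one_pow, one_mul]

/-- The summands of the majorant vanish at `i∞`: for `c ≠ 0` because `|cτ + d|` tends to infinity,
and for `c = 0` because then `Im Mτ = Im τ`. -/
lemma tendsto_norm_qParam_mul_inv_denom {k : ℕ} (hk : k ≠ 0) (M : Cosets) :
    Tendsto (fun τ : ℍ ↦ ‖𝕢 (M.out • τ : ℍ)‖ * (‖denom M.out τ‖ ^ k)⁻¹)
      UpperHalfPlane.atImInfty (𝓝 0) := by
  by_cases hc : M.out 1 0 = 0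
  · have hdet := M.out.det_coe
    rw [Matrix.det_fin_two, hc, mul_zero, sub_zero] at hdet
    have hd : |((M.out 1 1 : ℤ) : ℝ)| = 1 := by
      have := Int.isUnit_iff_abs_eq.mp (IsUnit.of_mul_eq_one (M.out 0 0) ((mul_comm _ _).trans hdet))
      exact_mod_cast this
    have hj : ∀ τ : ℍ, ‖denom M.out τ‖ = 1 := fun τ ↦ by
      rw [ModularGroup.denom_apply, hc]
      simp [Complex.norm_intCast, hd]
    have him : ∀ τ : ℍ, (M.out • τ).im = τ.im := fun τ ↦ by
      rw [ModularGroup.im_smul_eq_div_normSq, Complex.normSq_eq_norm_sq, hj]; simp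
    have hq := (UpperHalfPlane.qParam_tendsto_atImInfty one_pos).norm
    rw [norm_zero] at hq
    refine hq.congr fun τ ↦ ?_
    rw [hj, norm_qParam_eq, norm_qParam_eq, UpperHalfPlane.coe_im, UpperHalfPlane.coe_im, him]
    simp
  · have hc' : 0 < |((M.out 1 0 : ℤ) : ℝ)| := by simpa using hc
    have h1 : Tendsto (fun τ : ℍ ↦ ‖denom M.out τ‖) UpperHalfPlane.atImInfty atTop :=
      tendsto_atTop_mono (fun τ ↦ abs_mul_im_le_norm_denom M.out τ)
        ((tendsto_comap (f := UpperHalfPlane.im)).const_mul_atTop hc')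
    have h2 := ((tendsto_pow_atTop hk).comp h1).inv_tendsto_atTop
    refine squeeze_zero (fun τ ↦ by positivity) (fun τ ↦ ?_) h2
    exact mul_le_of_le_one_left (by positivity) (norm_qParam_lt_one _).le

/-- The holomorphic Poincaré series vanishes at `i∞`, uniformly for `w` in a half-plane. -/
lemma exists_norm_diffSeries_le_of_strip {k : ℕ} (hk : 3 ≤ k) (l : ℕ) (A : ℝ) {ρ : ℝ}
    (hρ0 : 0 ≤ ρ) (hρ : ρ < 1) {ε : ℝ} (hε : 0 < ε) :
    ∃ Y : ℝ, ∀ τ : ℍ, |τ.re| ≤ A → Y ≤ τ.im → ∀ w : ℂ, ‖𝕢 w‖ ≤ ρ → ‖diffSeries k l τ w‖ ≤ ε := by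
  obtain ⟨C, hC, hle⟩ := exists_norm_kernel_slash_le k l A one_pos hρ0 hρ
  obtain ⟨s, hs, h'⟩ := exists_mul_norm_bottomRow_le A one_pos
  set b : ℍ → Cosets → ℝ := fun τ M ↦ C * (‖𝕢 (M.out • τ : ℍ)‖ * (‖denom M.out τ‖ ^ k)⁻¹)
  set u : Cosets → ℝ := fun M ↦ C * ((s ^ k)⁻¹ * (‖bottomRow M‖ ^ k)⁻¹)
  have hu : Summable u := ((summable_norm_bottomRow hk).mul_left (s ^ k)⁻¹).mul_left C
  have hb0 : ∀ τ M, 0 ≤ b τ M := fun τ M ↦ by positivity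
  have hbu : ∀ τ ∈ UpperHalfPlane.verticalStrip A 1, ∀ M, b τ M ≤ u M := fun τ hτ M ↦
    mul_le_mul_of_nonneg_left (norm_qParam_mul_inv_denom_le hs (h' τ hτ M) k) hC
  have hlim : Tendsto (fun τ ↦ ∑' M, b τ M)
      (UpperHalfPlane.atImInfty ⊓ 𝓟 (UpperHalfPlane.verticalStrip A 1)) (𝓝 (∑' _ : Cosets, 0)) := by
    refine tendsto_tsum_of_dominated_convergence hu (fun M ↦ ?_) ?_
    · simpa [b] using ((tendsto_norm_qParam_mul_inv_denom (by omega) M).const_mul C).mono_left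
        inf_le_left
    · refine eventually_inf_principal.mpr (.of_forall fun τ hτ M ↦ ?_)
      rw [Real.norm_of_nonneg (hb0 τ M)]
      exact hbu τ hτ M
  rw [tsum_zero] at hlim
  have hev := eventually_inf_principal.mp (hlim.eventually_le_const hε)
  obtain ⟨Y, hY⟩ := (UpperHalfPlane.atImInfty_mem _).mp hev
  refine ⟨max Y 1, fun τ hre him w hw ↦ ?_⟩
  have hτ : τ ∈ UpperHalfPlane.verticalStrip A 1 := ⟨hre, (le_max_right _ _).trans him⟩
  refine le_trans ?_ (hY τ ((le_max_left _ _).trans him) hτ)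
  exact tsum_of_norm_bounded (hu.of_nonneg_of_le (hb0 τ) (hbu τ hτ)).hasSum
    fun M ↦ hle τ hτ w hw M

/-- Cauchy's estimate on the disc of radius `Im z / 2` about `z` transfers the vanishing at `i∞` to
the derivatives. -/
lemma exists_norm_iteratedDeriv_diffSeries_le_of_strip {k : ℕ} (hk : 3 ≤ k) (l r : ℕ) (z : ℍ)
    (A : ℝ) {ε : ℝ} (hε : 0 < ε) :
    ∃ Y : ℝ, ∀ τ : ℍ, |τ.re| ≤ A → Y ≤ τ.im → ‖iteratedDeriv r (diffSeries k l τ) z‖ ≤ ε := by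
  have hz := z.im_pos
  set R : ℝ := z.im / 2 with hR
  have hRpos : 0 < R := by positivity
  have him : ∀ w ∈ closedBall (z : ℂ) R, R ≤ w.im := fun w hw ↦ by
    have h1 := (abs_im_le_norm (w - z)).trans (by simpa [dist_eq_norm] using hw)
    have h2 := (abs_le.mp h1).1
    rw [sub_im, UpperHalfPlane.coe_im] at h2
    linarith
  have hε' : 0 < ε * R ^ r / r.factorial := by positivity
  obtain ⟨Y, hY⟩ := exists_norm_diffSeries_le_of_strip hk l A (Real.exp_pos _).le
    (exp_neg_two_pi_mul_lt_one hRpos) hε'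
  refine ⟨Y, fun τ h1 h2 ↦ ?_⟩
  have hsub : closedBall (z : ℂ) R ⊆ {w | 0 < w.im} := fun w hw ↦ hRpos.trans_le (him w hw)
  refine (norm_iteratedDeriv_le_of_forall_mem_sphere_norm_le r hRpos
    ((differentiableOn_diffSeries_right hk l τ).diffContOnCl_ball hsub)
    fun w hw ↦ hY τ h1 h2 w (norm_qParam_le (him w (sphere_subset_closedBall hw)))).trans ?_
  field_simp
  rfl

/-- The derivatives of `diffSeries` at a point of the upper half-plane are cusp forms. -/
def diffForm {k : ℕ} (hk : 3 ≤ k) (l r : ℕ) (z : ℍ) : CuspForm 𝒮ℒ ((k + 2 * l : ℕ) : ℤ) :=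
  have hinv : ∀ γ : SL(2, ℤ), (fun τ : ℍ ↦ 2 * (Real.pi : ℂ) * I *
      iteratedDeriv r (diffSeries k l τ) z) ∣[((k + 2 * l : ℕ) : ℤ)] γ =
      fun τ ↦ 2 * (Real.pi : ℂ) * I * iteratedDeriv r (diffSeries k l τ) z := fun γ ↦ by
    ext τ
    have hd : denom γ τ ≠ 0 := UpperHalfPlane.denom_ne_zero γ τ
    rw [ModularForm.SL_slash_apply, zpow_neg, zpow_natCast, mul_inv_eq_iff_eq_mul₀
      (pow_ne_zero _ hd)]
    rw [show diffSeries k l (γ • τ) = fun w ↦ denom γ τ ^ (k + 2 * l) * diffSeries k l τ w from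
      funext fun w ↦ diffSeries_smul k l γ τ w, iteratedDeriv_const_mul_field]
    ring
  { toFun := fun τ ↦ 2 * (Real.pi : ℂ) * I * iteratedDeriv r (diffSeries k l τ) z
    slash_action_eq' := by
      rintro _ ⟨γ, rfl⟩
      exact hinv γ
    holo' := by
      rw [UpperHalfPlane.mdifferentiable_iff]
      refine DifferentiableOn.const_mul ?_ _
      exact differentiableOn_iteratedDeriv_right UpperHalfPlane.isOpen_upperHalfPlaneSet
        UpperHalfPlane.isOpen_upperHalfPlaneSet r (D := fun τ w ↦ diffSeries k l (ofComplex τ) w)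
        (fun w hw ↦ differentiableOn_diffSeries_left hk l hw)
        (fun τ _ ↦ differentiableOn_diffSeries_right hk l _)
        (fun τ hτ w hw ↦ exists_eventually_norm_diffSeries_le hk l ⟨τ, hτ⟩ ⟨w, hw⟩) z z.im_pos
    zero_at_cusps' := by
      intro c hc
      rw [OnePoint.isZeroAt_iff_forall_SL2Z hc]
      intro γ _
      refine (hinv γ).symm ▸ UpperHalfPlane.isZeroAtImInfty_iff.mpr fun ε hε ↦ ?_
      obtain ⟨Y, hY⟩ := exists_norm_iteratedDeriv_diffSeries_le_of_strip hk l r z 1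
        (ε := ε / (2 * Real.pi)) (by positivity)
      refine ⟨Y, fun τ hτ ↦ ?_⟩
      -- The bound holds on a vertical strip of width `2`; periodicity moves `τ` there.
      obtain ⟨n, hn⟩ := UpperHalfPlane.ModularGroup_T_zpow_mem_verticalStrip τ one_pos
      have h := hY _ (by simpa using hn.1) (hτ.trans hn.2)
      rw [diffSeries_T_zpow_smul, le_div_iff₀' (by positivity)] at h
      simpa [abs_of_pos Real.pi_pos] using h }

/-! ### Convergence of the meromorphic Poincaré series -/

lemma im_smul_eq (γ : SL(2, ℤ)) (τ : ℍ) : (γ • τ).im = τ.im / ‖denom γ τ‖ ^ 2 := by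
  rw [ModularGroup.im_smul_eq_div_normSq, Complex.normSq_eq_norm_sq]

/-- `Im Mτ = Im τ / |cτ + d|²` tends to `0` along the cosets, as `∑ |cτ + d|⁻⁴` converges. -/
lemma finite_le_im_smul (τ : ℍ) {B : ℝ} (hB : 0 < B) :
    {M : Cosets | B ≤ (M.out • τ).im}.Finite := by
  have h := (((summable_norm_denom (k := 4) (by norm_num) τ).mul_left
    (τ.im ^ 2)).tendsto_cofinite_zero).eventually_lt_const (show 0 < B ^ 2 by positivity)
  refine h.subset fun M hM ↦ ?_
  simp only [mem_ofPred_eq, im_smul_eq] at hM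
  have := pow_le_pow_left₀ hB.le hM 2
  rw [div_pow, ← pow_mul, div_eq_mul_inv] at this
  simpa using this

lemma mem_orbit_of_qParam_eq {γ : SL(2, ℤ)} {τ z : ℍ} (h : 𝕢 (γ • τ : ℍ) = 𝕢 z) :
    τ ∈ MulAction.orbit SL(2, ℤ) z := by
  obtain ⟨n, hn⟩ := Complex.exp_eq_exp_iff_exists_int.mp h
  have h1 : ((γ • τ : ℍ) : ℂ) = z + n := by
    have hpi : (Real.pi : ℂ) ≠ 0 := by exact_mod_cast Real.pi_ne_zero
    simp only [ofReal_one, div_one] at hn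
    field_simp at hn
    exact hn
  have h2 : γ • τ = ModularGroup.T ^ n • z := by
    rw [UpperHalfPlane.modular_T_zpow_smul]
    ext
    rw [h1, UpperHalfPlane.coe_vadd, add_comm]
    simp
  exact ⟨γ⁻¹ * ModularGroup.T ^ n, by simp [mul_smul, ← h2]⟩

lemma exists_pos_le_of_finite {ι : Type*} {f : ι → ℝ} (hf : ∀ i, 0 < f i) {c : ℝ} (hc : 0 < c)
    (hfin : {i | f i < c}.Finite) : ∃ δ : ℝ, 0 < δ ∧ ∀ i, δ ≤ f i := by
  rcases {i | f i < c}.eq_empty_or_nonempty with h | h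
  · exact ⟨c, hc, fun i ↦ not_lt.mp fun hi ↦ (h ▸ (show i ∈ {i | f i < c} from hi) : i ∈ ∅)⟩
  · obtain ⟨i₀, hi₀, hmin⟩ := hfin.exists_minimalFor f _ h |>.imp fun _ h ↦ h
    refine ⟨f i₀, hf i₀, fun i ↦ ?_⟩
    by_cases hi : f i < c
    · exact (le_total (f i₀) (f i)).elim id (hmin hi)
    · exact (le_of_lt hi₀).trans (not_lt.mp hi)

/-- The poles of the Poincaré series stay away from `z` when `τ` is not equivalent to `z`. -/
lemma exists_nhds_le_norm_qParam_sub {τ z : ℍ} (h : τ ∉ MulAction.orbit SL(2, ℤ) z) :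
    ∃ δ : ℝ, 0 < δ ∧ ∃ V : Set ℂ, IsOpen V ∧ (z : ℂ) ∈ V ∧ V ⊆ {w | 0 < w.im} ∧
      ∀ w ∈ V, ∀ M : Cosets, δ ≤ ‖𝕢 (M.out • τ : ℍ) - 𝕢 w‖ := by
  have hz := z.im_pos
  set c := Real.exp (-2 * Real.pi * (z.im / 2)) - Real.exp (-2 * Real.pi * z.im)
  have hc : 0 < c := by
    refine sub_pos.mpr (Real.exp_lt_exp.mpr ?_)
    nlinarith [mul_pos Real.pi_pos hz]
  obtain ⟨δ, hδ, hle⟩ := exists_pos_le_of_finite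
    (f := fun M : Cosets ↦ ‖𝕢 (M.out • τ : ℍ) - 𝕢 z‖)
    (fun M ↦ norm_pos_iff.mpr (sub_ne_zero.mpr fun h' ↦ h (mem_orbit_of_qParam_eq h'))) hc
    ((finite_le_im_smul τ (half_pos hz)).subset fun M hM ↦ by
      by_contra! hlt
      simp only [mem_ofPred_eq, not_le] at hM hlt
      have h1 := norm_sub_norm_le (𝕢 (M.out • τ : ℍ)) (𝕢 z)
      have h2 : Real.exp (-2 * Real.pi * (z.im / 2)) ≤ ‖𝕢 (M.out • τ : ℍ)‖ := by
        rw [norm_qParam_eq, UpperHalfPlane.coe_im]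
        exact Real.exp_le_exp.mpr
          (mul_le_mul_of_nonpos_left hlt.le (by linarith [Real.pi_pos]))
      have h3 : ‖𝕢 z‖ = Real.exp (-2 * Real.pi * z.im) := norm_qParam_eq z
      simp only [c] at hM
      linarith)
  refine ⟨δ / 2, half_pos hδ, {w | 0 < w.im} ∩ {w | ‖𝕢 w - 𝕢 z‖ < δ / 2}, ?_, ⟨hz, ?_⟩,
    inter_subset_left, fun w hw M ↦ ?_⟩
  · exact UpperHalfPlane.isOpen_upperHalfPlaneSet.inter
      (isOpen_lt (by fun_prop) continuous_const)
  · simpa using hδ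
  · have h1 := hle M
    have h2 := hw.2
    have h3 := norm_sub_le_norm_sub_add_norm_sub (𝕢 (M.out • τ : ℍ)) (𝕢 w) (𝕢 z)
    simp only [mem_ofPred_eq] at h1 h2
    linarith

lemma poincareTerm_eq (m : ℤ) (l : ℕ) (τ : ℍ) (w : ℂ) (M : Cosets) :
    poincareTerm m l τ w M = (((M.out • τ).im : ℂ) ^ l)⁻¹ *
      (1 - Complex.exp (2 * (Real.pi : ℂ) * I * (w - (M.out • τ : ℍ))))⁻¹ *
        denom M.out τ ^ (-m) := by
  conv_lhs => rw [← M.out_eq]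
  change (seed l w ∣[m] M.out) τ = _
  rw [ModularForm.SL_slash_apply, seed, div_eq_mul_inv]

/-- The factor `(Im Mτ)^(-l)` contributes `|cτ + d|^(2l)`, which lowers the weight from `k + 2l` to
`k`; away from the poles the rest is bounded. -/
lemma norm_poincareTerm_le {k l : ℕ} {τ : ℍ} {w : ℂ} {M : Cosets} {δ : ℝ} (hδ : 0 < δ)
    (h : δ ≤ ‖𝕢 (M.out • τ : ℍ) - 𝕢 w‖) :
    ‖poincareTerm (k + 2 * l : ℕ) l τ w M‖ ≤
      (τ.im ^ l)⁻¹ * δ⁻¹ * (‖denom M.out τ‖ ^ k)⁻¹ := by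
  have hj : 0 < ‖denom M.out τ‖ := norm_pos_iff.mpr (UpperHalfPlane.denom_ne_zero M.out τ)
  have hy := τ.im_pos
  have h1 : ‖((((M.out • τ).im : ℂ)) ^ l)⁻¹‖ = (τ.im ^ l)⁻¹ * ‖denom M.out τ‖ ^ (2 * l) := by
    rw [norm_inv, norm_pow, Complex.norm_real, Real.norm_of_nonneg (M.out • τ).im_pos.le,
      im_smul_eq, div_pow, inv_div, ← pow_mul]
    field_simp
  have h2 : ‖(1 - Complex.exp (2 * (Real.pi : ℂ) * I * (w - (M.out • τ : ℍ))))⁻¹‖ ≤ δ⁻¹ := by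
    rw [one_sub_exp_eq, inv_div, norm_div, div_eq_mul_inv]
    exact (mul_le_of_le_one_left (by positivity) (norm_qParam_lt_one _).le).trans
      (inv_anti₀ hδ h)
  rw [poincareTerm_eq, norm_mul, norm_mul, h1, zpow_neg, zpow_natCast,
    norm_inv (denom M.out τ ^ _), norm_pow]
  calc _ ≤ (τ.im ^ l)⁻¹ * ‖denom M.out τ‖ ^ (2 * l) * δ⁻¹ * (‖denom M.out τ‖ ^ (k + 2 * l))⁻¹ := by
        gcongr
    _ = _ := by rw [pow_add]; field_simp

lemma differentiableOn_poincareTerm (m : ℤ) (l : ℕ) (τ : ℍ) (M : Cosets) {V : Set ℂ}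
    (hV : ∀ w ∈ V, 𝕢 (M.out • τ : ℍ) ≠ 𝕢 w) :
    DifferentiableOn ℂ (fun w ↦ poincareTerm m l τ w M) V := by
  simp_rw [poincareTerm_eq]
  refine (DifferentiableOn.const_mul (DifferentiableOn.inv (by fun_prop) fun w hw ↦ ?_) _).mul_const _
  rw [one_sub_exp_eq]
  exact div_ne_zero (sub_ne_zero.mpr (hV w hw)) (Function.Periodic.qParam_ne_zero _)

lemma summable_norm_poincareTerm {k : ℕ} (hk : 3 ≤ k) (l : ℕ) {τ : ℍ} {w : ℂ} {δ : ℝ}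
    (hδ : 0 < δ) (h : ∀ M : Cosets, δ ≤ ‖𝕢 (M.out • τ : ℍ) - 𝕢 w‖) :
    Summable fun M ↦ ‖poincareTerm (k + 2 * l : ℕ) l τ w M‖ :=
  ((summable_norm_denom hk τ).mul_left ((τ.im ^ l)⁻¹ * δ⁻¹)).of_nonneg_of_le
    (fun _ ↦ norm_nonneg _) fun M ↦ norm_poincareTerm_le hδ (h M)

lemma ne_of_le_norm_sub {p q : ℂ} {δ : ℝ} (hδ : 0 < δ) (h : δ ≤ ‖p - q‖) : p ≠ q :=
  sub_ne_zero.mp (norm_pos_iff.mp (hδ.trans_le h))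

lemma convergesAt_of_notMem_orbit {k : ℕ} (hk : 3 ≤ k) (l : ℕ) {τ z : ℍ}
    (h : τ ∉ MulAction.orbit SL(2, ℤ) z) : ConvergesAt (k + 2 * l : ℕ) l τ z := by
  obtain ⟨δ, hδ, V, hV, hz, -, hle⟩ := exists_nhds_le_norm_qParam_sub h
  refine ⟨eventually_of_mem (hV.mem_nhds hz) fun w hw ↦
    summable_norm_poincareTerm hk l hδ (hle w hw), ?_⟩
  refine DifferentiableOn.analyticAt (s := V) ?_ (hV.mem_nhds hz)
  exact DifferentiableOn.const_mul (differentiableOn_tsum_of_summable_norm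
    ((summable_norm_denom hk τ).mul_left ((τ.im ^ l)⁻¹ * δ⁻¹))
    (fun M ↦ differentiableOn_poincareTerm _ l τ M fun w hw ↦ ne_of_le_norm_sub hδ (hle w hw M)) hV
    fun M w hw ↦ norm_poincareTerm_le hδ (hle w hw M)) _

/-! ### Comparison of the Poincaré series -/

/-- The binomial theorem for `E₂(Mτ)^l = ((cτ + d)² Ê₂(τ) + 3 / (π Im Mτ))^l`, multiplied by the
summand of the Poincaré series. -/
lemma sum_poincareTerm_sub_eq {k l : ℕ} {τ z : ℍ} {M : Cosets} (h : 𝕢 (M.out • τ : ℍ) ≠ 𝕢 z) :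
    ∑ j ∈ Finset.range (l + 1), (l.choose j : ℂ) * (3 / (Real.pi : ℂ)) ^ (l - j) * E2hat τ ^ j *
        poincareTerm (((k + 2 * l : ℕ) : ℤ) - 2 * (j : ℤ)) (l - j) τ z M -
      EisensteinSeries.E2 z ^ l * poincareTerm ((k + 2 * l : ℕ) : ℤ) 0 τ z M =
    (kernel (fun q ↦ E2disc q ^ l) z ∣[((k + 2 * l : ℕ) : ℤ)] M.out) τ := by
  have hd : denom M.out τ ≠ 0 := UpperHalfPlane.denom_ne_zero M.out τ
  rw [ModularForm.SL_slash_apply, kernel_of_ne h, E2disc_qParam, E2disc_qParam,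
    E2_smul_eq_E2hat, add_pow]
  simp only [poincareTerm_eq, pow_zero, inv_one, one_mul]
  rw [div_eq_mul_inv _ (1 - Complex.exp _), sub_mul, sub_mul, Finset.sum_mul, Finset.sum_mul,
    mul_assoc (EisensteinSeries.E2 z ^ l)]
  congr 1
  refine Finset.sum_congr rfl fun j _ ↦ ?_
  rw [neg_sub, sub_eq_add_neg (2 * (j : ℤ)), zpow_add₀ hd, zpow_mul, zpow_natCast, zpow_ofNat,
    mul_pow, mul_pow, inv_pow]
  ring

lemma weight_sub_eq (k : ℕ) {l j : ℕ} (hj : j ≤ l) :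
    ((k + 2 * l : ℕ) : ℤ) - 2 * (j : ℤ) = ((k + 2 * (l - j) : ℕ) : ℤ) := by
  omega

lemma two_pi_I_mul_diffSeries {k : ℕ} (hk : 3 ≤ k) (l : ℕ) {τ z : ℍ} {δ : ℝ} (hδ : 0 < δ)
    (h : ∀ M : Cosets, δ ≤ ‖𝕢 (M.out • τ : ℍ) - 𝕢 z‖) :
    2 * (Real.pi : ℂ) * I * diffSeries k l τ z =
      ∑ j ∈ Finset.range (l + 1), (l.choose j : ℂ) * (3 / (Real.pi : ℂ)) ^ (l - j) *
        E2hat τ ^ j * H (((k + 2 * l : ℕ) : ℤ) - 2 * (j : ℤ)) (l - j) τ z -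
      EisensteinSeries.E2 z ^ l * H ((k + 2 * l : ℕ) : ℤ) 0 τ z := by
  have h0 := (summable_norm_poincareTerm (k := k + 2 * l) (by omega) 0 hδ h).of_norm.hasSum
  have hj : ∀ j ∈ Finset.range (l + 1), HasSum
      (poincareTerm (((k + 2 * l : ℕ) : ℤ) - 2 * (j : ℤ)) (l - j) τ z)
      (∑' M, poincareTerm (((k + 2 * l : ℕ) : ℤ) - 2 * (j : ℤ)) (l - j) τ z M) := fun j hj ↦ by
    rw [weight_sub_eq k (Nat.lt_succ_iff.mp (Finset.mem_range.mp hj))]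
    exact (summable_norm_poincareTerm hk (l - j) hδ h).of_norm.hasSum
  have hsum := (hasSum_sum fun j hj' ↦ (hj j hj').mul_left
      ((l.choose j : ℂ) * (3 / (Real.pi : ℂ)) ^ (l - j) * E2hat τ ^ j)).sub
    (h0.mul_left (EisensteinSeries.E2 z ^ l))
  have hkey : diffSeries k l τ z = _ := (tsum_congr fun M ↦
    (sum_poincareTerm_sub_eq (ne_of_le_norm_sub hδ (h M))).symm).trans hsum.tsum_eq
  rw [hkey, mul_sub, Finset.mul_sum]
  congr 1
  · refine Finset.sum_congr rfl fun j _ ↦ ?_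
    rw [H]; ring
  · rw [H]; ring_nf

lemma F_sub_E2HDeriv {k : ℕ} (hk : 3 ≤ k) (l r : ℕ) {τ z : ℍ}
    (h : τ ∉ MulAction.orbit SL(2, ℤ) z) :
    2 * (Real.pi : ℂ) * I * iteratedDeriv r (diffSeries k l τ) z =
      F r (k + 2 * l : ℕ) l τ z - E2HDeriv r (k + 2 * l : ℕ) l τ z := by
  obtain ⟨δ, hδ, V, hV, hz, hVim, hle⟩ := exists_nhds_le_norm_qParam_sub h
  have hE2 : AnalyticAt ℂ (fun w ↦ EisensteinSeries.E2 (ofComplex w)) z :=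
    (UpperHalfPlane.mdifferentiable_iff.mp E2_mdifferentiable).analyticAt
      (UpperHalfPlane.isOpen_upperHalfPlaneSet.mem_nhds z.im_pos)
  have hHj : ∀ j ∈ Finset.range (l + 1),
      AnalyticAt ℂ (fun w ↦ H (((k + 2 * l : ℕ) : ℤ) - 2 * (j : ℤ)) (l - j) τ w) z := fun j hj ↦ by
    rw [weight_sub_eq k (Nat.lt_succ_iff.mp (Finset.mem_range.mp hj))]
    exact (convergesAt_of_notMem_orbit hk _ h).2
  have hH : AnalyticAt ℂ (fun w ↦ H ((k + 2 * l : ℕ) : ℤ) 0 τ w) z :=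
    (convergesAt_of_notMem_orbit (k := k + 2 * l) (by omega) 0 h).2
  have heq : (fun w ↦ 2 * (Real.pi : ℂ) * I * diffSeries k l τ w) =ᶠ[𝓝 (z : ℂ)] fun w ↦
      ∑ j ∈ Finset.range (l + 1), (l.choose j : ℂ) * (3 / (Real.pi : ℂ)) ^ (l - j) *
        E2hat τ ^ j * H (((k + 2 * l : ℕ) : ℤ) - 2 * (j : ℤ)) (l - j) τ w -
      EisensteinSeries.E2 (ofComplex w) ^ l * H ((k + 2 * l : ℕ) : ℤ) 0 τ w := by
    filter_upwards [hV.mem_nhds hz] with w hw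
    rw [UpperHalfPlane.ofComplex_apply_of_im_pos (hVim hw)]
    exact two_pi_I_mul_diffSeries hk l (z := ⟨w, hVim hw⟩) hδ (hle w hw)
  have hA : ∀ j ∈ Finset.range (l + 1), AnalyticAt ℂ (fun w ↦ (l.choose j : ℂ) *
      (3 / (Real.pi : ℂ)) ^ (l - j) * E2hat τ ^ j *
        H (((k + 2 * l : ℕ) : ℤ) - 2 * (j : ℤ)) (l - j) τ w) z :=
    fun j hj ↦ analyticAt_const.mul (hHj j hj)
  have hB : AnalyticAt ℂ
      (fun w ↦ EisensteinSeries.E2 (ofComplex w) ^ l * H ((k + 2 * l : ℕ) : ℤ) 0 τ w) z :=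
    (hE2.fun_pow l).fun_mul hH
  rw [← iteratedDeriv_const_mul_field, heq.iteratedDeriv_eq,
    iteratedDeriv_fun_sub (Finset.analyticAt_fun_sum _ hA).contDiffAt hB.contDiffAt,
    iteratedDeriv_fun_sum fun j hj ↦ (hA j hj).contDiffAt]
  simp_rw [iteratedDeriv_const_mul_field]
  rfl

end MeroPoincare

end

theorem proposition4p4 (m : ℤ) (l r : ℕ) (hm : Even m) (hml : 4 + 2 * (l : ℤ) ≤ m)
    (z : ℍ) (hz : ¬ MeroPoincare.IsEllipticPoint z) :
    (∀ τ : ℍ, τ ∉ MulAction.orbit SL(2, ℤ) z →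
      MeroPoincare.ConvergesAt m 0 τ z ∧
        ∀ j ≤ l, MeroPoincare.ConvergesAt (m - 2 * (j : ℤ)) (l - j) τ z) ∧
    ∃ f : CuspForm 𝒮ℒ m, ∀ τ : ℍ, τ ∉ MulAction.orbit SL(2, ℤ) z →
      f τ = MeroPoincare.F r m l τ z - MeroPoincare.E2HDeriv r m l τ z := by
  obtain ⟨k, hk, rfl⟩ : ∃ k : ℕ, 3 ≤ k ∧ m = ((k + 2 * l : ℕ) : ℤ) :=
    ⟨(m - 2 * l).toNat, by omega, by omega⟩
  refine ⟨fun τ hτ ↦ ⟨?_, fun j hj ↦ ?_⟩, MeroPoincare.diffForm hk l r z, fun τ hτ ↦ ?_⟩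
  · exact MeroPoincare.convergesAt_of_notMem_orbit (k := k + 2 * l) (by omega) 0 hτ
  · rw [MeroPoincare.weight_sub_eq k hj]
    exact MeroPoincare.convergesAt_of_notMem_orbit hk (l - j) hτ
  · exact MeroPoincare.F_sub_E2HDeriv hk l r hτ
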